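/- Let $k$ be an algebraically closed field of characteristic zero. A Lie subalgebra $\mathfrak h$ of a finite-dimensional semisimple Lie algebra $\mathfrak g$ over $k$ is called *wide* in $\mathfrak g$ if no simple finite-dimensional $\mathfrak g$-module can be written as a direct sum of two proper $\mathfrak h$-submodules. Let $$\mathfrak e_3=\left\{\begin{pmatrix}A&B\\0&A\end{pmatrix}\;\middle|\;A,B\in\mathfrak{sl}_2(k)\right\}\subset\mathfrak{sl}_4(k),\qquad \Psi=\begin{pmatrix}0&0&0&1\\0&0&-1&0\\0&1&0&0\\-1&0&0&0\end{pmatrix},$$ and $\mathfrak{sp}_4=\{M\in\mathfrak{sl}_4(k)\mid \Psi M+M^{t}\Psi=0\}$, which contains $\mathfrak e_3$. Let $\mathfrak t=\{\mathrm{diag}(x_1,x_2,-x_2,-x_1)\}$ be the diagonal Cartan subalgebra of $\mathfrak{sp}_4$, with simple roots $\alpha_1=x_1-x_2$ (short) and $\alpha_2=2x_2$ (long). Let $\mathfrak p(2)$ be the maximal parabolic subalgebra of $\mathfrak{sp}_4$ that is the sum of $\mathfrak t$ and of the root spaces of the roots $c_1\alpha_1+c_2\alpha_2$ with $c_2\ge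 0$; its nilradical $\mathfrak p(2)_{nil}$ is the sum of the root spaces with $c_2>0$. Then: 1. $\mathfrak e_3$ is isomorphic to the euclidean Lie algebra $\mathfrak{so}_3\ltimes k^3$, where $k^3$ is an abelian ideal on which $\mathfrak{so}_3$ acts by its standard representation; 2. $\mathfrak e_3$ is wide in $\mathfrak{sp}_4$; 3. $\mathfrak e_3$ is not wide in $\mathfrak{sl}_4$; 4. $\mathfrak p(2)_{nil}\subset\mathfrak e_3$. -/

import Mathlib

universe u v

-- The commutator bracket on an associative ring, used here for matrices.
attribute [local instance 100] LieRing.ofAssociativeRing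

noncomputable section

namespace WideSubalgebra

section General

variable (k : Type u) [Field k] {g : Type v} [LieRing g] [LieAlgebra k g]

/-- For a Lie subalgebra `h` of `g`, a `g`-module `V` is `h`-indecomposable if it is not the direct
sum of two proper `h`-submodules. -/
def IsIndecomposableOver (h : LieSubalgebra k g) (V : Type*) [AddCommGroup V] [Module k V]
    [LieRingModule g V] [LieModule k g V] : Prop :=
  ¬ ∃ N₁ N₂ : LieSubmodule k h V, N₁ ≠ ⊤ ∧ N₂ ≠ ⊤ ∧ IsCompl N₁ N₂

/-- A Lie subalgebra `h` of `g` is wide if every simple finite-dimensional `g`-module is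
`h`-indecomposable. Every finite-dimensional module is isomorphic to one that lives in the universe
of the field, so that quantifying over this universe loses nothing. -/
def IsWide (h : LieSubalgebra k g) : Prop :=
  ∀ (V : Type u) [AddCommGroup V] [Module k V] [LieRingModule g V] [LieModule k g V],
    FiniteDimensional k V → LieModule.IsIrreducible k g V → IsIndecomposableOver k h V

variable {k}

/-- Let `H` be a Cartan subalgebra with simple roots `α i`. The nilradical of the standard
parabolic subalgebra attached to a set `S` of simple roots is the sum of the root spaces of the
roots `γ = ∑ i, c i • α i` (with integers `c i`) of positive `S`-height `∑ i ∈ S, c i`; the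
parabolic subalgebra itself is `H` plus the sum of the root spaces with `S`-height `≥ 0`.
The root space of `γ` is the space of all `x` such that `⁅t, x⁆ = γ t • x` for every `t` in `H`;
it vanishes if `γ` is neither `0` nor a root. -/
def parabolicNilradical (H : LieSubalgebra k g) {ι : Type*} [Fintype ι]
    (α : ι → Module.Dual k H) (S : Finset ι) : LieSubmodule k H g :=
  ⨆ (c : ι → ℤ) (_ : 0 < ∑ i ∈ S, c i), LieModule.weightSpace g ⇑(∑ i, c i • α i)

end General

section Matrices

variable (k : Type u) [Field k]

/-- The matrix of the skew-symmetric form `ψ` on `k⁴`. -/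
def Psi : Matrix (Fin 4) (Fin 4) k :=
  !![0, 0, 0, 1; 0, 0, -1, 0; 0, 1, 0, 0; -1, 0, 0, 0]

/-- The Lie algebra `sl₄`. -/
abbrev sl4 : LieSubalgebra k (Matrix (Fin 4) (Fin 4) k) :=
  LieAlgebra.SpecialLinear.sl (Fin 4) k

/-- The Lie algebra `sp₄`: the matrices `M` in `sl₄` with `Mᵀ Ψ = Ψ (-M)`. -/
def sp4 : LieSubalgebra k (Matrix (Fin 4) (Fin 4) k) :=
  sl4 k ⊓ skewAdjointMatricesLieSubalgebra (Psi k)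

/-- The `4 × 4` matrix with the `2 × 2` blocks `A B` in the first row and `0 A` in the second. -/
def blockMatrix (A B : Matrix (Fin 2) (Fin 2) k) : Matrix (Fin 4) (Fin 4) k :=
  Matrix.reindex finSumFinEquiv finSumFinEquiv (Matrix.fromBlocks A B 0 A)

theorem blockMatrix_eq (A B : Matrix (Fin 2) (Fin 2) k) :
    blockMatrix k A B =
      !![A 0 0, A 0 1, B 0 0, B 0 1;
         A 1 0, A 1 1, B 1 0, B 1 1;
         0, 0, A 0 0, A 0 1;
         0, 0, A 1 0, A 1 1] := by
  ext i j
  fin_cases i <;> fin_cases j <;> rfl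

theorem blockMatrix_mul (A B C D : Matrix (Fin 2) (Fin 2) k) :
    blockMatrix k A B * blockMatrix k C D = blockMatrix k (A * C) (A * D + B * C) := by
  simp [blockMatrix, Matrix.fromBlocks_multiply]

theorem blockMatrix_sub (A B C D : Matrix (Fin 2) (Fin 2) k) :
    blockMatrix k A B - blockMatrix k C D = blockMatrix k (A - C) (B - D) := by
  simp only [blockMatrix_eq]
  ext i j
  fin_cases i <;> fin_cases j <;> simp

/-- The euclidean Lie algebra `e₃` inside `sl₄`: the block matrices with blocks `A B` and `0 A`,
where `A` and `B` have trace zero. -/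
def e3 : LieSubalgebra k (Matrix (Fin 4) (Fin 4) k) where
  carrier := {M | ∃ A B : LieAlgebra.SpecialLinear.sl (Fin 2) k,
    M = blockMatrix k (A : Matrix (Fin 2) (Fin 2) k) (B : Matrix (Fin 2) (Fin 2) k)}
  zero_mem' := by
    refine ⟨0, 0, ?_⟩
    simp [blockMatrix]
  add_mem' := by
    rintro _ _ ⟨A, B, rfl⟩ ⟨C, D, rfl⟩
    refine ⟨A + C, B + D, ?_⟩
    simp only [blockMatrix_eq]
    ext i j
    fin_cases i <;> fin_cases j <;> simp
  smul_mem' := by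
    rintro c _ ⟨A, B, rfl⟩
    refine ⟨c • A, c • B, ?_⟩
    simp only [blockMatrix_eq]
    ext i j
    fin_cases i <;> fin_cases j <;> simp
  lie_mem' := by
    rintro _ _ ⟨A, B, rfl⟩ ⟨C, D, rfl⟩
    refine ⟨⁅A, C⁆, ⁅A, D⁆ + ⁅B, C⁆, ?_⟩
    rw [LieRing.of_associative_ring_bracket, blockMatrix_mul, blockMatrix_mul, blockMatrix_sub]
    congr 1
    change _ = ((A : Matrix (Fin 2) (Fin 2) k) * D.1 - D.1 * A.1) + (B.1 * C.1 - C.1 * B.1)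
    abel

theorem e3_le_sp4 : e3 k ≤ sp4 k := by
  rintro _ ⟨⟨A, hA⟩, ⟨B, hB⟩, rfl⟩
  have hA' : A 0 0 + A 1 1 = 0 := by
    have : A.trace = 0 := hA
    simpa [Matrix.trace_fin_two] using this
  have hB' : B 0 0 + B 1 1 = 0 := by
    have : B.trace = 0 := hB
    simpa [Matrix.trace_fin_two] using this
  have eA : A 1 1 = -A 0 0 := (neg_eq_of_add_eq_zero_right hA').symm
  have eB : B 1 1 = -B 0 0 := (neg_eq_of_add_eq_zero_right hB').symm
  refine ⟨?_, ?_⟩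
  · change Matrix.trace (blockMatrix k A B) = 0
    rw [blockMatrix_eq]
    simp [Matrix.trace, Fin.sum_univ_four, eA]
  · change (blockMatrix k A B) ∈ skewAdjointMatricesSubmodule (Psi k)
    rw [mem_skewAdjointMatricesSubmodule]
    change Matrix.transpose (blockMatrix k A B) * Psi k = Psi k * (-(blockMatrix k A B))
    rw [blockMatrix_eq]
    ext i j
    fin_cases i <;> fin_cases j <;>
      simp [Psi, Matrix.mul_apply, Fin.sum_univ_four, eA, eB]

theorem e3_le_sl4 : e3 k ≤ sl4 k := (e3_le_sp4 k).trans inf_le_left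

/-- `e₃` as a Lie subalgebra of `sp₄`. -/
def e3InSp4 : LieSubalgebra k (sp4 k) := LieSubalgebra.ofLe (e3_le_sp4 k)

/-- `e₃` as a Lie subalgebra of `sl₄`. -/
def e3InSl4 : LieSubalgebra k (sl4 k) := LieSubalgebra.ofLe (e3_le_sl4 k)

/-- The Cartan subalgebra of `sp₄` that consists of its diagonal matrices; these are the matrices
`diag (x₁, x₂, -x₂, -x₁)`. -/
def diagonalSp4 : LieSubalgebra k (sp4 k) where
  carrier := {M | (M : Matrix (Fin 4) (Fin 4) k).IsDiag}
  zero_mem' := Matrix.isDiag_zero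
  add_mem' := fun ha hb => Matrix.IsDiag.add ha hb
  smul_mem' := fun c _ ha => Matrix.IsDiag.smul c ha
  lie_mem' := by
    intro x y hx hy
    change Matrix.IsDiag ((x : Matrix (Fin 4) (Fin 4) k) * (y : Matrix (Fin 4) (Fin 4) k) -
      (y : Matrix (Fin 4) (Fin 4) k) * (x : Matrix (Fin 4) (Fin 4) k))
    rw [← Matrix.IsDiag.diagonal_diag hx, ← Matrix.IsDiag.diagonal_diag hy,
      Matrix.diagonal_mul_diagonal, Matrix.diagonal_mul_diagonal]
    exact (Matrix.isDiag_diagonal _).sub (Matrix.isDiag_diagonal _)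

/-- The linear form that takes the `i`-th diagonal entry of a diagonal matrix in `sp₄`. -/
def diagonalEntry (i : Fin 4) : Module.Dual k (diagonalSp4 k) where
  toFun t := (t : Matrix (Fin 4) (Fin 4) k) i i
  map_add' _ _ := rfl
  map_smul' _ _ := rfl

/-- The simple roots of `sp₄`: at `diag (x₁, x₂, -x₂, -x₁)`, the short one is `x₁ - x₂` and the
long one is `2 x₂ = x₂ - (-x₂)`. The corresponding positive roots are those of the strictly upper
triangular matrices in `sp₄`. -/
def simpleRootSp4 : Fin 2 → Module.Dual k (diagonalSp4 k) :=
  ![diagonalEntry k 0 - diagonalEntry k 1, diagonalEntry k 1 - diagonalEntry k 2]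

/-- The nilradical of the maximal parabolic subalgebra `p(2)` of `sp₄`, which is attached to the
long simple root. -/
def p2Nilradical : LieSubmodule k (diagonalSp4 k) (sp4 k) :=
  parabolicNilradical (diagonalSp4 k) (simpleRootSp4 k) {1}

/-- The commutator bracket on `k³`, with the coordinatewise product, is zero. -/
theorem bracket_fin3 (a b : Fin 3 → k) : ⁅a, b⁆ = 0 := by
  ext i
  exact sub_eq_zero.mpr (mul_comm (a i) (b i))

/-- The action of `so₃` on the abelian Lie algebra `k³` by matrix multiplication. -/
def so3Action : LieAlgebra.Orthogonal.so (Fin 3) k →ₗ⁅k⁆ LieDerivation k (Fin 3 → k) (Fin 3 → k)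
    where
  toFun X :=
    { toLinearMap := Matrix.mulVecLin (X : Matrix (Fin 3) (Fin 3) k)
      leibniz' := fun a b => by simp [bracket_fin3] }
  map_add' X Y := by ext; simp
  map_smul' c X := by ext; simp
  map_lie' := by
    intro X Y
    ext
    simp [LieRing.of_associative_ring_bracket]

/-- The euclidean Lie algebra as an abstract Lie algebra: the semidirect product of `so₃` with the
abelian ideal `k³`. -/
abbrev Euclidean3 : Type u :=
  LieAlgebra.SemiDirectSum (Fin 3 → k) (LieAlgebra.Orthogonal.so (Fin 3) k) (so3Action k)

end Matrices

end WideSubalgebra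

end

namespace WideSubalgebra

open Module LieModule

section LinearAlgebra

variable {k : Type*} [Field k] {V : Type*} [AddCommGroup V] [Module k V] [FiniteDimensional k V]

theorem isSemisimple_of_iSup_eigenspace_eq_top {f : End k V} (hf : ⨆ μ, f.eigenspace μ = ⊤) :
    f.IsSemisimple := by
  classical
  set s : Finset k := (End.finite_hasEigenvalue f).toFinset
  refine End.isSemisimple_of_squarefree_aeval_eq_zero
    (p := ∏ μ ∈ s, (Polynomial.X - Polynomial.C μ)) ?_ ?_
  · exact (Polynomial.separable_prod_X_sub_C_iff' (f := id)).2 (fun _ _ _ _ h => h) |>.squarefree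
  · rw [← LinearMap.ker_eq_top, eq_top_iff, ← hf, iSup_le_iff]
    intro μ v hv
    by_cases hμ : f.HasEigenvalue μ
    · have hs : μ ∈ s := by simpa [s] using hμ
      rw [LinearMap.mem_ker, ← Finset.prod_erase_mul _ _ hs, map_mul, End.mul_apply]
      simp [End.mem_eigenspace_iff.1 hv]
    · have : f.eigenspace μ = ⊥ := by simpa [End.hasEigenvalue_iff] using hμ
      rw [this, Submodule.mem_bot] at hv
      simp [hv]

theorem aeval_mulRight {A : Type*} [Ring A] [Algebra k A] (a : A) (p : Polynomial k) :
    Polynomial.aeval (LinearMap.mulRight k a) p = LinearMap.mulRight k (Polynomial.aeval a p) := by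
  induction p using Polynomial.induction_on' with
  | add p q hp hq => ext; simp [hp, hq, mul_add]
  | monomial n c =>
    ext x
    simp [Polynomial.aeval_monomial, LinearMap.pow_mulRight]
    simp [Algebra.algebraMap_eq_smul_one]

theorem isSemisimple_mulLeft [PerfectField k] {f : End k V} (hf : f.IsSemisimple) :
    End.IsSemisimple (LinearMap.mulLeft k f) := by
  refine End.isSemisimple_of_squarefree_aeval_eq_zero hf.minpoly_squarefree ?_
  have := Polynomial.aeval_algHom_apply (Algebra.lmul k (End k V)) f (minpoly k f)
  rw [minpoly.aeval, map_zero] at this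
  exact this

theorem isSemisimple_mulRight [PerfectField k] {f : End k V} (hf : f.IsSemisimple) :
    End.IsSemisimple (LinearMap.mulRight k f) := by
  refine End.isSemisimple_of_squarefree_aeval_eq_zero hf.minpoly_squarefree ?_
  rw [aeval_mulRight, minpoly.aeval, LinearMap.mulRight_zero_eq_zero]

theorem eq_zero_or_eq_one_of_trace [CharZero k] {p : End k V} (hp : IsIdempotentElem p) {c : k}
    (hc : c = 0 ∨ c = 1) (ht : LinearMap.trace k V p = c * finrank k V) : p = 0 ∨ p = 1 := by
  have hr : LinearMap.trace k V p = finrank k (LinearMap.range p) :=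
    (LinearMap.isProj_range_iff_isIdempotentElem p |>.2 hp).trace
  rw [hr] at ht
  rcases hc with rfl | rfl
  · left
    rw [zero_mul, Nat.cast_eq_zero, Submodule.finrank_eq_zero] at ht
    exact LinearMap.range_eq_bot.1 ht
  · right
    rw [one_mul, Nat.cast_inj] at ht
    have hu : IsUnit p := (LinearMap.isUnit_iff_range_eq_top p).2 (Submodule.eq_top_of_finrank_eq ht)
    exact hu.mul_left_cancel (by rw [hp, mul_one])

end LinearAlgebra

section Indecomposable

variable {k : Type*} [Field k] {g : Type*} [LieRing g] [LieAlgebra k g]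
  {V : Type*} [AddCommGroup V] [Module k V] [LieRingModule g V] [LieModule k g V]

theorem lie_mem_of_lieSpan_eq_top {s : Set g} (hs : LieSubalgebra.lieSpan k g s = ⊤)
    {U : Submodule k V} (hU : ∀ x ∈ s, ∀ v ∈ U, ⁅x, v⁆ ∈ U) (x : g) {v : V} (hv : v ∈ U) :
    ⁅x, v⁆ ∈ U := by
  have hx : x ∈ LieSubalgebra.lieSpan k g s := hs ▸ LieSubalgebra.mem_top x
  induction hx using LieSubalgebra.lieSpan_induction generalizing v with
  | mem x hx => exact hU x hx v hv
  | zero => simp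
  | add x y _ _ hx hy => rw [add_lie]; exact U.add_mem (hx hv) (hy hv)
  | smul c x _ hx => rw [smul_lie]; exact U.smul_mem c (hx hv)
  | lie x y _ _ hx hy => rw [lie_lie]; exact U.sub_mem (hx (hy hv)) (hy (hx hv))

theorem lie_eq_zero_of_lieSpan_eq_top {s : Set g} (hs : LieSubalgebra.lieSpan k g s = ⊤)
    {v : V} (hv : ∀ x ∈ s, ⁅x, v⁆ = 0) (x : g) : ⁅x, v⁆ = 0 := by
  have hx : x ∈ LieSubalgebra.lieSpan k g s := hs ▸ LieSubalgebra.mem_top x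
  induction hx using LieSubalgebra.lieSpan_induction with
  | mem x hx => exact hv x hx
  | zero => simp
  | add x y _ _ hx hy => rw [add_lie, hx, hy, add_zero]
  | smul c x _ hx => rw [smul_lie, hx, smul_zero]
  | lie x y _ _ hx hy => rw [lie_lie, hx, hy, lie_zero, lie_zero, sub_zero]

theorem toEnd_end_eq (h : g) : toEnd k g (End k V) h =
    LinearMap.mulLeft k (toEnd k g V h) - LinearMap.mulRight k (toEnd k g V h) := by
  ext φ v
  simp [LieHom.lie_apply]

/-- The endomorphisms of `V` that commute with the action of a set `s`. -/
def commutant (k : Type*) [Field k] {g : Type*} [LieRing g] [LieAlgebra k g]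
    (V : Type*) [AddCommGroup V] [Module k V] [LieRingModule g V] [LieModule k g V]
    (s : Set g) : Submodule k (End k V) where
  carrier := {φ | ∀ x ∈ s, ⁅x, φ⁆ = 0}
  zero_mem' := fun x _ => lie_zero x
  add_mem' := fun ha hb x hx => by rw [lie_add, ha x hx, hb x hx, add_zero]
  smul_mem' := fun c a ha x hx => by rw [lie_smul, ha x hx, smul_zero]

theorem lie_mul_end (x : g) (φ ψ : End k V) : ⁅x, φ * ψ⁆ = ⁅x, φ⁆ * ψ + φ * ⁅x, ψ⁆ := by
  ext v
  simp [LieHom.lie_apply]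

theorem trace_lie_end (x : g) (φ : End k V) : LinearMap.trace k V ⁅x, φ⁆ = 0 := by
  have : ⁅x, φ⁆ = toEnd k g V x * φ - φ * toEnd k g V x := by
    ext v; simp [LieHom.lie_apply]
  rw [this, map_sub, LinearMap.trace_mul_comm, sub_self]

variable [IsAlgClosed k] [FiniteDimensional k V]

theorem iSup_eigenspace_toEnd_eq_top [LieModule.IsIrreducible k g V] {s : Set g}
    (hs : LieSubalgebra.lieSpan k g s = ⊤) {h : g} (hh : ∀ x ∈ s, ∃ c : k, ⁅h, x⁆ = c • x) :
    ⨆ μ, (toEnd k g V h).eigenspace μ = ⊤ := by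
  have := LieModule.nontrivial_of_isIrreducible k g V
  set U : Submodule k V := ⨆ μ, (toEnd k g V h).eigenspace μ
  let N : LieSubmodule k g V :=
    { U with
      lie_mem := fun {x v} hv => by
        refine lie_mem_of_lieSpan_eq_top hs (U := U) (fun x hx v hv => ?_) x hv
        obtain ⟨c, hc⟩ := hh x hx
        induction hv using Submodule.iSup_induction' with
        | mem μ v hv =>
          refine Submodule.mem_iSup_of_mem (c + μ) ?_
          rw [End.mem_eigenspace_iff, toEnd_apply_apply] at hv ⊢
          rw [leibniz_lie, hc, hv, smul_lie, lie_smul, add_smul]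
        | zero => simp
        | add v w _ _ hv hw => rw [lie_add]; exact U.add_mem hv hw }
  have hN : N ≠ ⊥ := by
    intro hN
    obtain ⟨μ, hμ⟩ := End.exists_eigenvalue (toEnd k g V h)
    obtain ⟨v, hv, hv0⟩ := hμ.exists_hasEigenvector
    have : v ∈ N := Submodule.mem_iSup_of_mem μ hv
    rw [hN] at this
    exact hv0 ((LieSubmodule.mem_bot v).1 this)
  have := (eq_bot_or_eq_top N).resolve_left hN
  exact (LieSubmodule.toSubmodule_eq_top _).2 this

theorem exists_eq_smul_one_of_lie_eq_zero [LieModule.IsIrreducible k g V] {φ : End k V}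
    (hφ : ∀ x : g, ⁅x, φ⁆ = 0) : ∃ c : k, φ = c • 1 := by
  have := LieModule.nontrivial_of_isIrreducible k g V
  obtain ⟨c, hc⟩ := End.exists_eigenvalue φ
  have hcomm (x : g) (v : V) : φ ⁅x, v⁆ = ⁅x, φ v⁆ := by
    have := LinearMap.congr_fun (hφ x) v
    rw [LieHom.lie_apply, LinearMap.zero_apply, sub_eq_zero] at this
    exact this.symm
  let N : LieSubmodule k g V :=
    { φ.eigenspace c with
      lie_mem := fun {x v} hv => by
        change ⁅x, v⁆ ∈ φ.eigenspace c
        replace hv : v ∈ φ.eigenspace c := hv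
        rw [End.mem_eigenspace_iff] at hv ⊢
        rw [hcomm, hv, lie_smul] }
  have hN : N ≠ ⊥ := by
    intro hN
    obtain ⟨v, hv, hv0⟩ := hc.exists_hasEigenvector
    have : v ∈ N := hv
    rw [hN] at this
    exact hv0 ((LieSubmodule.mem_bot v).1 this)
  have htop := (eq_bot_or_eq_top N).resolve_left hN
  refine ⟨c, LinearMap.ext fun v => ?_⟩
  have : v ∈ N := htop ▸ LieSubmodule.mem_top v
  exact End.mem_eigenspace_iff.1 this

variable [CharZero k]

theorem iSup_eigenspace_toEnd_end_eq_top {h : g} (hh : ⨆ μ, (toEnd k g V h).eigenspace μ = ⊤) :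
    ⨆ μ, (toEnd k g (End k V) h).eigenspace μ = ⊤ := by
  have hss := isSemisimple_of_iSup_eigenspace_eq_top hh
  refine End.IsSemisimple.iSup_eigenspace_eq_top ?_
  rw [toEnd_end_eq]
  exact (isSemisimple_mulLeft hss).sub_of_commute (LinearMap.commute_mulLeft_right _ _)
    (isSemisimple_mulRight hss)


theorem isIndecomposableOver_of_lieSpan_eq_top [LieModule.IsIrreducible k g V] {h e f : g}
    (t : IsSl2Triple h e f) {s : Set g} (he : e ∈ s) (hs : ∀ x ∈ s, ∃ c : k, ⁅h, x⁆ = c • x)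
    (hgen : LieSubalgebra.lieSpan k g (insert f s) = ⊤) {H : LieSubalgebra k g}
    (hH : s ⊆ H) : IsIndecomposableOver k H V := by
  have := LieModule.nontrivial_of_isIrreducible k g V
  rintro ⟨N₁, N₂, h₁, h₂, hcompl⟩
  have hdiag : ⨆ μ, (toEnd k g V h).eigenspace μ = ⊤ := by
    refine iSup_eigenspace_toEnd_eq_top hgen ?_
    rintro x (rfl | hx)
    · exact ⟨-2, by rw [t.lie_lie_smul_f k, neg_smul]⟩
    · exact hs x hx
  replace hdiag := iSup_eigenspace_toEnd_end_eq_top hdiag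
  set E := commutant k V s
  set F : k → Submodule k (End k V) := (toEnd k g (End k V) h).eigenspace
  set J : Submodule k (End k V) := ⨆ n : ℕ, E ⊓ F (n + 1)
  have hFlie {μ : k} {φ : End k V} (hφ : φ ∈ F μ) : ⁅h, φ⁆ = μ • φ := End.mem_eigenspace_iff.1 hφ
  have hFtrace {μ : k} {φ : End k V} (hφ : φ ∈ F μ) (hμ : μ ≠ 0) : LinearMap.trace k V φ = 0 := by
    have := trace_lie_end h φ
    rw [hFlie hφ, map_smul, smul_eq_mul, mul_eq_zero] at this
    exact this.resolve_left hμ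
  have hFmul {μ ν : k} {φ ψ : End k V} (hφ : φ ∈ F μ) (hψ : ψ ∈ F ν) : φ * ψ ∈ F (μ + ν) := by
    refine End.mem_eigenspace_iff.2 ?_
    rw [toEnd_apply_apply, lie_mul_end, hFlie hφ, hFlie hψ, smul_mul_assoc, mul_smul_comm, add_smul]
  have hJtrace {j : End k V} (hj : j ∈ J) : LinearMap.trace k V j = 0 := by
    induction hj using Submodule.iSup_induction' with
    | mem n j hj => exact hFtrace hj.2 (Nat.cast_add_one_ne_zero n)
    | zero => simp
    | add a b _ _ ha hb => rw [map_add, ha, hb, add_zero]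
  have hJtrace_mul {i j : End k V} (hi : i ∈ J) (hj : j ∈ J) :
      LinearMap.trace k V (i * j) = 0 := by
    induction hi using Submodule.iSup_induction' with
    | mem n i hi =>
      induction hj using Submodule.iSup_induction' with
      | mem m j hj =>
        refine hFtrace (hFmul hi.2 hj.2) ?_
        exact_mod_cast (by omega : n + 1 + (m + 1) ≠ 0)
      | zero => simp
      | add a b _ _ ha hb => rw [mul_add, map_add, ha, hb, add_zero]
    | zero => simp
    | add a b _ _ ha hb => rw [add_mul, map_add, ha, hb, add_zero]
  have hEinv : ∀ φ ∈ E, toEnd k g (End k V) h φ ∈ E := by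
    intro φ hφ x hx
    obtain ⟨c, hc⟩ := hs x hx
    rw [toEnd_apply_apply, leibniz_lie, ← lie_skew, hc, hφ x hx, lie_zero, neg_lie, smul_lie,
      hφ x hx, smul_zero, neg_zero, add_zero]
  have hEF (μ : k) : E ⊓ F μ ≤ Submodule.span k {1} ⊔ J := by
    rintro φ ⟨hφE, hφ⟩
    by_cases h0 : φ = 0
    · rw [h0]; exact zero_mem _
    have P : t.HasPrimitiveVectorWith φ μ := ⟨h0, hFlie hφ, hφE e he⟩
    obtain ⟨n, rfl⟩ := P.exists_nat
    cases n with
    | zero =>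
      have hf : ⁅f, φ⁆ = 0 := by simpa using P.pow_toEnd_f_eq_zero_of_eq_nat rfl
      obtain ⟨c, rfl⟩ := exists_eq_smul_one_of_lie_eq_zero (φ := φ)
        (lie_eq_zero_of_lieSpan_eq_top hgen (by
          rintro x (rfl | hx)
          · exact hf
          · exact hφE x hx))
      exact Submodule.mem_sup_left (Submodule.smul_mem _ _ (Submodule.mem_span_singleton_self _))
    | succ n =>
      refine Submodule.mem_sup_right (Submodule.mem_iSup_of_mem n ⟨hφE, ?_⟩)
      simpa using hφ
  have hEle : E ≤ Submodule.span k {1} ⊔ J := by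
    have := Submodule.eq_iSup_inf_genEigenspace 1 hEinv hdiag
    rw [this]
    exact iSup_le hEF
  have hc' : IsCompl N₁.toSubmodule N₂.toSubmodule := LieSubmodule.isCompl_toSubmodule.2 hcompl
  set p : End k V := N₁.toSubmodule.projection N₂.toSubmodule hc'
  have hp₁ {v : V} (hv : v ∈ N₁) : p v = v := Submodule.projection_apply_of_mem_left hc' hv
  have hp₂ {v : V} (hv : v ∈ N₂) : p v = 0 := (Submodule.projection_apply_eq_zero_iff hc').2 hv
  have hpE : p ∈ E := by
    intro x hx
    ext v
    obtain ⟨v₁, hv₁, v₂, hv₂, rfl⟩ := Submodule.mem_sup.1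
      (hc'.sup_eq_top ▸ Submodule.mem_top : v ∈ N₁.toSubmodule ⊔ N₂.toSubmodule)
    have hx₁ : ⁅x, v₁⁆ ∈ N₁ := N₁.lie_mem (x := ⟨x, hH hx⟩) hv₁
    have hx₂ : ⁅x, v₂⁆ ∈ N₂ := N₂.lie_mem (x := ⟨x, hH hx⟩) hv₂
    rw [LieHom.lie_apply, lie_add, map_add, map_add, hp₁ hv₁, hp₂ hv₂, hp₁ hx₁, hp₂ hx₂]
    simp
  have hpi : IsIdempotentElem p := Submodule.isIdempotentElem_projection hc'
  obtain ⟨a, ha, j, hj, hpj⟩ := Submodule.mem_sup.1 (hEle hpE)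
  obtain ⟨c, rfl⟩ := Submodule.mem_span_singleton.1 ha
  have htr : LinearMap.trace k V p = c * finrank k V := by
    rw [← hpj, map_add, map_smul, LinearMap.trace_one, hJtrace hj, add_zero, smul_eq_mul]
  have hsq : p * p = (c * c) • 1 + (2 * c) • j + j * j := by
    rw [← hpj]
    simp only [add_mul, mul_add, smul_mul_assoc, mul_smul_comm, one_mul, mul_one]
    module
  have hcc : c = 0 ∨ c = 1 := by
    have h2 : LinearMap.trace k V (p * p) = c * c * finrank k V := by
      rw [hsq, map_add, map_add, map_smul, map_smul, LinearMap.trace_one, hJtrace hj,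
        hJtrace_mul hj hj, smul_zero, add_zero, add_zero, smul_eq_mul]
    rw [hpi, htr] at h2
    have hd : (finrank k V : k) ≠ 0 := by exact_mod_cast finrank_pos.ne'
    have := mul_right_cancel₀ hd h2
    rcases eq_or_ne c 0 with h0 | h0
    · exact Or.inl h0
    · exact Or.inr (mul_left_cancel₀ h0 (by rw [mul_one, ← this]))
  rcases eq_zero_or_eq_one_of_trace hpi hcc htr with hp0 | hp1
  · refine h₂ ((LieSubmodule.toSubmodule_eq_top _).1
      (Submodule.eq_top_iff'.2 fun v => ?_))
    exact (Submodule.projection_apply_eq_zero_iff hc').1 (LinearMap.congr_fun hp0 v)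
  · refine h₁ ((LieSubmodule.toSubmodule_eq_top _).1
      (Submodule.eq_top_iff'.2 fun v => ?_))
    have hv : p v = v := LinearMap.congr_fun hp1 v
    exact hv ▸ Submodule.projection_apply_mem hc' v

end Indecomposable

section Euclidean

variable (k : Type*) [Field k]

/-- The linear map `k³ → sl₂` that turns the cross product into the commutator, where `I² = -1`. -/
def crossToSl2 (I : k) (v : Fin 3 → k) : Matrix (Fin 2) (Fin 2) k :=
  (2⁻¹ : k) • !![-I * v 2, -I * v 0 - v 1; -I * v 0 + v 1, I * v 2]

/-- The matrix of the cross product with a vector. -/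
def crossMatrix (v : Fin 3 → k) : Matrix (Fin 3) (Fin 3) k :=
  !![0, -v 2, v 1; v 2, 0, -v 0; -v 1, v 0, 0]

/-- The axis of a skew-symmetric matrix. -/
def axis (X : Matrix (Fin 3) (Fin 3) k) : Fin 3 → k := ![X 2 1, X 0 2, X 1 0]

variable {k}

theorem crossMatrix_axis {X : Matrix (Fin 3) (Fin 3) k} [CharZero k]
    (hX : X ∈ LieAlgebra.Orthogonal.so (Fin 3) k) : crossMatrix k (axis k X) = X := by
  rw [LieAlgebra.Orthogonal.mem_so] at hX
  have h (i j) : X j i = -X i j := congr_fun (congr_fun hX i) j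
  have h0 (i) : X i i = 0 := self_eq_neg.1 (h i i)
  ext i j
  fin_cases i <;> fin_cases j <;> simp [crossMatrix, axis, h0]
  · rw [h 0 1]; simp
  · rw [h 1 2]; simp
  · rw [h 2 0]; simp

theorem crossMatrix_mem_so (v : Fin 3 → k) :
    crossMatrix k v ∈ LieAlgebra.Orthogonal.so (Fin 3) k := by
  rw [LieAlgebra.Orthogonal.mem_so]
  ext i j
  fin_cases i <;> fin_cases j <;> simp [crossMatrix]

theorem crossToSl2_mem_sl (I : k) (v : Fin 3 → k) :
    crossToSl2 k I v ∈ LieAlgebra.SpecialLinear.sl (Fin 2) k := by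
  change Matrix.trace (crossToSl2 k I v) = 0
  simp [crossToSl2, Matrix.trace_fin_two]

theorem crossToSl2_cross [CharZero k] {I : k} (hI : I * I = -1) (v w : Fin 3 → k) :
    crossToSl2 k I (crossProduct v w) =
      crossToSl2 k I v * crossToSl2 k I w - crossToSl2 k I w * crossToSl2 k I v := by
  have hI' : I ^ 2 = -1 := by rw [sq, hI]
  ext i j
  fin_cases i <;> fin_cases j <;>
    simp [crossToSl2, cross_apply] <;>
    field_simp <;> ring_nf <;> simp [hI'] <;> ring

theorem crossToSl2_add (I : k) (v w : Fin 3 → k) :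
    crossToSl2 k I (v + w) = crossToSl2 k I v + crossToSl2 k I w := by
  ext i j
  fin_cases i <;> fin_cases j <;> simp [crossToSl2] <;> ring

theorem crossToSl2_smul (I c : k) (v : Fin 3 → k) :
    crossToSl2 k I (c • v) = c • crossToSl2 k I v := by
  ext i j
  fin_cases i <;> fin_cases j <;> simp [crossToSl2] <;> ring

theorem crossToSl2_surjective [CharZero k] {I : k} (hI : I * I = -1)
    {A : Matrix (Fin 2) (Fin 2) k} (hA : A ∈ LieAlgebra.SpecialLinear.sl (Fin 2) k) :
    ∃ v, crossToSl2 k I v = A := by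
  replace hA : A 0 0 + A 1 1 = 0 := by
    rw [← Matrix.trace_fin_two]; exact hA
  refine ⟨![I * (A 0 1 + A 1 0), A 1 0 - A 0 1, 2 * I * A 0 0], ?_⟩
  ext i j
  fin_cases i <;> fin_cases j <;> simp [crossToSl2] <;> field_simp <;> grind

theorem crossToSl2_injective [CharZero k] {I : k} (hI : I * I = -1) :
    Function.Injective (crossToSl2 k I) := by
  have hI0 : I ≠ 0 := by rintro rfl; simp at hI
  intro v w h
  have h00 := congr_fun (congr_fun h 0) 0
  have h01 := congr_fun (congr_fun h 0) 1
  have h10 := congr_fun (congr_fun h 1) 0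
  simp [crossToSl2] at h00 h01 h10
  ext i
  fin_cases i
  · exact mul_left_cancel₀ (mul_ne_zero two_ne_zero hI0) (show 2 * I * v 0 = 2 * I * w 0 by linear_combination -h01 - h10)
  · exact mul_left_cancel₀ (two_ne_zero' k) (show 2 * v 1 = 2 * w 1 by linear_combination h10 - h01)
  · simpa [hI0] using h00

theorem mulVec_eq_cross [CharZero k] {X : Matrix (Fin 3) (Fin 3) k}
    (hX : X ∈ LieAlgebra.Orthogonal.so (Fin 3) k) (v : Fin 3 → k) :
    X.mulVec v = crossProduct (axis k X) v := by
  conv_lhs => rw [← crossMatrix_axis hX]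
  ext i
  fin_cases i <;> simp [crossMatrix, cross_apply, Matrix.mulVec, dotProduct, Fin.sum_univ_three] <;>
    ring

theorem axis_lie [CharZero k] {X Y : Matrix (Fin 3) (Fin 3) k}
    (hX : X ∈ LieAlgebra.Orthogonal.so (Fin 3) k) (hY : Y ∈ LieAlgebra.Orthogonal.so (Fin 3) k) :
    axis k (X * Y - Y * X) = crossProduct (axis k X) (axis k Y) := by
  conv_lhs => rw [← crossMatrix_axis hX, ← crossMatrix_axis hY]
  generalize axis k X = v
  generalize axis k Y = w
  ext i
  fin_cases i <;>
    simp [axis, crossMatrix, cross_apply] <;> ring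

theorem blockMatrix_injective {A B C D : Matrix (Fin 2) (Fin 2) k}
    (h : blockMatrix k A B = blockMatrix k C D) : A = C ∧ B = D := by
  have := (Matrix.reindex _ _).injective h
  rw [Matrix.fromBlocks_inj] at this
  exact ⟨this.1, this.2.1⟩

theorem blockMatrix_add (A B C D : Matrix (Fin 2) (Fin 2) k) :
    blockMatrix k (A + C) (B + D) = blockMatrix k A B + blockMatrix k C D := by
  simp [blockMatrix_eq]

theorem blockMatrix_smul (c : k) (A B : Matrix (Fin 2) (Fin 2) k) :
    blockMatrix k (c • A) (c • B) = c • blockMatrix k A B := by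
  simp [blockMatrix_eq]

variable (k) in
/-- The isomorphism of the euclidean Lie algebra with `e₃`, as a homomorphism. -/
def euclideanToE3 [CharZero k] {I : k} (hI : I * I = -1) : Euclidean3 k →ₗ⁅k⁆ e3 k where
  toFun x := ⟨blockMatrix k (crossToSl2 k I (axis k x.right.1)) (crossToSl2 k I x.left),
    ⟨_, crossToSl2_mem_sl I _⟩, ⟨_, crossToSl2_mem_sl I _⟩, rfl⟩
  map_add' x y := by
    apply Subtype.ext
    change _ = blockMatrix k _ _ + blockMatrix k _ _
    rw [← blockMatrix_add, ← crossToSl2_add, ← crossToSl2_add]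
    congr 2
  map_smul' c x := by
    apply Subtype.ext
    change _ = c • blockMatrix k _ _
    rw [← blockMatrix_smul, ← crossToSl2_smul, ← crossToSl2_smul]
    congr 2
  map_lie' := by
    rintro ⟨v, X, hX⟩ ⟨w, Y, hY⟩
    apply Subtype.ext
    change blockMatrix k (crossToSl2 k I (axis k (X * Y - Y * X)))
      (crossToSl2 k I (⁅v, w⁆ + X.mulVec w - Y.mulVec v)) =
      blockMatrix k _ _ * blockMatrix k _ _ - blockMatrix k _ _ * blockMatrix k _ _
    rw [blockMatrix_mul, blockMatrix_mul, blockMatrix_sub, bracket_fin3, zero_add,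
      mulVec_eq_cross hX, mulVec_eq_cross hY, axis_lie hX hY, crossToSl2_cross hI,
      sub_eq_add_neg (crossProduct _ _), cross_anticomm, crossToSl2_add, crossToSl2_cross hI,
      crossToSl2_cross hI]
    congr 1
    abel

theorem euclideanToE3_bijective [CharZero k] {I : k} (hI : I * I = -1) :
    Function.Bijective (euclideanToE3 k hI) := by
  constructor
  · rintro ⟨v, X, hX⟩ ⟨w, Y, hY⟩ h
    obtain ⟨h₁, h₂⟩ := blockMatrix_injective (congr_arg Subtype.val h)
    obtain rfl := crossToSl2_injective hI h₂
    have := crossToSl2_injective hI h₁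
    obtain rfl : X = Y := by rw [← crossMatrix_axis hX, ← crossMatrix_axis hY]; congr 1
    rfl
  · rintro ⟨_, ⟨A, hA⟩, ⟨B, hB⟩, rfl⟩
    obtain ⟨v, rfl⟩ := crossToSl2_surjective hI hA
    obtain ⟨w, rfl⟩ := crossToSl2_surjective hI hB
    refine ⟨⟨w, crossMatrix k v, crossMatrix_mem_so v⟩, Subtype.ext ?_⟩
    change blockMatrix k (crossToSl2 k I (axis k (crossMatrix k v))) _ = _
    congr 2
    ext i
    fin_cases i <;> rfl

theorem nonempty_e3_equiv_euclidean3 (k : Type*) [Field k] [IsAlgClosed k] [CharZero k] :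
    Nonempty (e3 k ≃ₗ⁅k⁆ Euclidean3 k) := by
  obtain ⟨I, hI⟩ := IsAlgClosed.exists_pow_nat_eq (-1 : k) two_pos
  rw [sq] at hI
  exact ⟨(LieEquiv.ofBijective _ (euclideanToE3_bijective hI)).symm⟩

end Euclidean

section Symplectic

variable {k : Type*} [Field k]

theorem mem_sp4_iff {M : Matrix (Fin 4) (Fin 4) k} :
    M ∈ sp4 k ↔ M.trace = 0 ∧ M.transpose * Psi k = Psi k * (-M) :=
  and_congr Iff.rfl (mem_skewAdjointMatricesSubmodule (Psi k) M)

/-- The matrix in `sp₄` with prescribed entries. -/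
def sp4Matrix (a b c d p q r s u v : k) : sp4 k :=
  ⟨!![a, b, p, q; c, d, r, -p; s, u, -d, b; v, -s, c, -a], by
    refine mem_sp4_iff.2 ⟨?_, ?_⟩
    · simp [Matrix.trace, Fin.sum_univ_four]
    · ext i j
      fin_cases i <;> fin_cases j <;> simp [Psi, Matrix.mul_apply, Fin.sum_univ_four]⟩

set_option maxHeartbeats 1000000 in
theorem sp4Matrix_lie (a b c d p q r s u v a' b' c' d' p' q' r' s' u' v' : k) :
    ⁅sp4Matrix a b c d p q r s u v, sp4Matrix a' b' c' d' p' q' r' s' u' v'⁆ =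
      sp4Matrix (b * c' + p * s' + q * v' - (b' * c + p' * s + q' * v))
        (a * b' + b * d' + p * u' - q * s' - (a' * b + b' * d + p' * u - q' * s))
        (c * a' + d * c' + r * s' - p * v' - (c' * a + d' * c + r' * s - p' * v))
        (c * b' + r * u' + p * s' - (c' * b + r' * u + p' * s))
        (a * p' + b * r' - p * d' + q * c' - (a' * p + b' * r - p' * d + q' * c))
        (a * q' - b * p' + p * b' - q * a' - (a' * q - b' * p + p' * b - q' * a))
        (c * p' + d * r' - r * d' - p * c' - (c' * p + d' * r - r' * d - p' * c))
        (s * a' + u * c' - d * s' + b * v' - (s' * a + u' * c - d' * s + b' * v))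
        (s * b' + u * d' - d * u' - b * s' - (s' * b + u' * d - d' * u - b' * s))
        (v * a' - s * c' + c * s' - a * v' - (v' * a - s' * c + c' * s - a' * v)) := by
  apply Subtype.ext
  change (sp4Matrix a b c d p q r s u v).1 * (sp4Matrix a' b' c' d' p' q' r' s' u' v').1 -
    (sp4Matrix a' b' c' d' p' q' r' s' u' v').1 * (sp4Matrix a b c d p q r s u v).1 = _
  simp only [sp4Matrix]
  ext i j
  fin_cases i <;> fin_cases j <;> simp <;> ring

theorem sp4Matrix_add (a b c d p q r s u v a' b' c' d' p' q' r' s' u' v' : k) :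
    sp4Matrix a b c d p q r s u v + sp4Matrix a' b' c' d' p' q' r' s' u' v' =
      sp4Matrix (a + a') (b + b') (c + c') (d + d') (p + p') (q + q') (r + r') (s + s') (u + u')
        (v + v') := by
  apply Subtype.ext
  change (sp4Matrix a b c d p q r s u v).1 + (sp4Matrix a' b' c' d' p' q' r' s' u' v').1 = _
  simp [sp4Matrix, add_comm]

theorem sp4Matrix_smul (t a b c d p q r s u v : k) :
    t • sp4Matrix a b c d p q r s u v =
      sp4Matrix (t * a) (t * b) (t * c) (t * d) (t * p) (t * q) (t * r) (t * s) (t * u)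
        (t * v) := by
  apply Subtype.ext
  change t • (sp4Matrix a b c d p q r s u v).1 = _
  simp [sp4Matrix]

theorem exists_eq_sp4Matrix (M : sp4 k) :
    ∃ a b c d p q r s u v, M = sp4Matrix a b c d p q r s u v := by
  obtain ⟨M, hM⟩ := M
  have h := (mem_sp4_iff.1 hM).2
  have h' (i j) := congr_fun (congr_fun h i) j
  simp only [Psi, Matrix.mul_apply, Fin.sum_univ_four] at h'
  refine ⟨M 0 0, M 0 1, M 1 0, M 1 1, M 0 2, M 0 3, M 1 2, M 2 0, M 2 1, M 3 0, Subtype.ext ?_⟩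
  have h00 := h' 0 0
  have h01 := h' 0 1
  have h02 := h' 0 2
  have h03 := h' 0 3
  have h12 := h' 1 2
  have h13 := h' 1 3
  have h23 := h' 2 3
  simp at h00 h01 h02 h03 h12 h13 h23
  ext i j
  fin_cases i <;> fin_cases j <;> simp [sp4Matrix] <;> grind

theorem sp4Matrix_mem_e3 (p q r : k) : sp4Matrix 0 0 0 0 p q r 0 0 0 ∈ e3InSp4 k := by
  rw [e3InSp4, LieSubalgebra.mem_ofLe]
  refine ⟨0, ⟨!![p, q; r, -p], ?_⟩, ?_⟩
  · change Matrix.trace !![p, q; r, -p] = 0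
    simp [Matrix.trace_fin_two]
  · rw [blockMatrix_eq]
    simp [sp4Matrix]

theorem p2Nilradical_le_e3 [CharZero k] :
    (p2Nilradical k).toSubmodule ≤ (e3InSp4 k).toSubmodule := by
  rw [p2Nilradical, parabolicNilradical, LieSubmodule.iSup_toSubmodule, iSup_le_iff]
  intro c
  rw [LieSubmodule.iSup_toSubmodule, iSup_le_iff]
  intro hc M hM
  rw [Finset.sum_singleton] at hc
  have ht : sp4Matrix (1 : k) 0 0 1 0 0 0 0 0 0 ∈ diagonalSp4 k := by
    change Matrix.IsDiag _
    intro i j hij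
    fin_cases i <;> fin_cases j <;> simp [sp4Matrix] at hij ⊢
  have h := (LieModule.mem_weightSpace _ _).1 hM ⟨_, ht⟩
  obtain ⟨a, b, c', d, p, q, r, s, u, v, rfl⟩ := exists_eq_sp4Matrix M
  change ⁅sp4Matrix (1 : k) 0 0 1 0 0 0 0 0 0, sp4Matrix a b c' d p q r s u v⁆ = _ at h
  have hw : (∑ i, c i • simpleRootSp4 k i) ⟨sp4Matrix (1 : k) 0 0 1 0 0 0 0 0 0, ht⟩ = 2 * c 1 := by
    rw [Fin.sum_univ_two]
    have hE (i : Fin 4) : diagonalEntry k i ⟨sp4Matrix (1 : k) 0 0 1 0 0 0 0 0 0, ht⟩ =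
      (sp4Matrix (1 : k) 0 0 1 0 0 0 0 0 0).1 i i := rfl
    simp [simpleRootSp4, hE]
    simp [sp4Matrix]
    ring
  rw [hw, sp4Matrix_lie, sp4Matrix_smul] at h
  have hc0 : (c 1 : k) ≠ 0 := by exact_mod_cast hc.ne'
  have hc1 : (c 1 : k) + 1 ≠ 0 := by exact_mod_cast (by omega : c 1 + 1 ≠ 0)
  have h' (i j) := congr_fun (congr_fun (congr_arg Subtype.val h) i) j
  have ha := h' 0 0
  have hb := h' 0 1
  have hcc := h' 1 0
  have hd := h' 1 1
  have hs := h' 2 0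
  have hu := h' 2 1
  have hv := h' 3 0
  simp [sp4Matrix, hc0] at ha hb hcc hd hs hu hv
  have key {x : k} (hx : -x - x = 2 * c 1 * x) : x = 0 := by
    have : 2 * ((c 1 : k) + 1) * x = 0 := by linear_combination -hx
    simpa [hc1] using this
  have hs0 : s = 0 := key (by linear_combination hs)
  have hu0 : u = 0 := key (by linear_combination hu)
  have hv0 : v = 0 := key (by linear_combination hv)
  subst ha hb hcc hd hs0 hu0 hv0
  exact sp4Matrix_mem_e3 p q r

theorem lieSpan_sp4_eq_top [CharZero k] :
    LieSubalgebra.lieSpan k (sp4 k) (insert (sp4Matrix 0 0 0 0 0 0 0 0 1 1)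
      (Set.range fun x : k × k × k => sp4Matrix 0 0 0 0 x.1 x.2.1 x.2.2 0 0 0)) = ⊤ := by
  set S := LieSubalgebra.lieSpan k (sp4 k) (insert (sp4Matrix 0 0 0 0 0 0 0 0 1 1)
    (Set.range fun x : k × k × k => sp4Matrix 0 0 0 0 x.1 x.2.1 x.2.2 0 0 0))
  have hf : sp4Matrix 0 0 0 0 0 0 0 0 1 1 ∈ S := LieSubalgebra.subset_lieSpan (Or.inl rfl)
  have hn (p q r : k) : sp4Matrix 0 0 0 0 p q r 0 0 0 ∈ S :=
    LieSubalgebra.subset_lieSpan (Or.inr ⟨(p, q, r), rfl⟩)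
  have hfn (p q r : k) : sp4Matrix (-q) (-p) p (-r) 0 0 0 0 0 0 ∈ S := by
    simpa [sp4Matrix_lie] using S.lie_mem hf (hn p q r)
  have hdiag (a d : k) : sp4Matrix a 0 0 d 0 0 0 0 0 0 ∈ S := by
    simpa using hfn 0 (-a) (-d)
  have hsymm (b : k) : sp4Matrix 0 b b 0 0 0 0 0 0 0 ∈ S := by
    simpa [sp4Matrix_lie] using S.lie_mem (hdiag 1 0) (hfn (-b) 0 0)
  have hlevi (a b c d : k) : sp4Matrix a b c d 0 0 0 0 0 0 ∈ S := by
    have := S.add_mem (S.add_mem (hdiag a d) (hsymm ((b + c) / 2))) (hfn ((c - b) / 2) 0 0)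
    rw [sp4Matrix_add, sp4Matrix_add] at this
    convert this using 1
    congr 1 <;> field_simp <;> ring
  have huv (u v : k) : sp4Matrix 0 0 0 0 0 0 0 0 u v ∈ S := by
    have := S.lie_mem (hdiag (-v / 2) (-u / 2)) hf
    rw [sp4Matrix_lie] at this
    convert this using 1
    congr 1 <;> field_simp <;> ring
  have hsu (s : k) : sp4Matrix 0 0 0 0 0 0 0 s 0 0 ∈ S := by
    simpa [sp4Matrix_lie] using S.lie_mem (hlevi 0 s 0 0) (huv 0 1)
  rw [eq_top_iff]
  rintro M -
  obtain ⟨a, b, c, d, p, q, r, s, u, v, rfl⟩ := exists_eq_sp4Matrix M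
  simpa [sp4Matrix_add] using
    S.add_mem (S.add_mem (S.add_mem (hlevi a b c d) (hn p q r)) (hsu s)) (huv u v)

theorem isSl2Triple_sp4 [CharZero k] : IsSl2Triple (sp4Matrix (1 : k) 0 0 1 0 0 0 0 0 0)
    (sp4Matrix 0 0 0 0 0 1 1 0 0 0) (sp4Matrix 0 0 0 0 0 0 0 0 1 1) where
  h_ne_zero h := by
    have := congr_fun (congr_fun (congr_arg Subtype.val h) 0) 0
    simp [sp4Matrix] at this
  lie_e_f := by simp [sp4Matrix_lie]
  lie_h_e_nsmul := by
    simp [sp4Matrix_lie, two_smul, sp4Matrix_add]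
  lie_h_f_nsmul := by
    rw [eq_neg_iff_add_eq_zero, sp4Matrix_lie, two_smul, sp4Matrix_add, sp4Matrix_add]
    apply Subtype.ext
    ext i j
    fin_cases i <;> fin_cases j <;> simp [sp4Matrix]

theorem isWide_e3InSp4 (k : Type u) [Field k] [IsAlgClosed k] [CharZero k] :
    IsWide k (e3InSp4 k) := by
  intro V _ _ _ _ _ _
  refine isIndecomposableOver_of_lieSpan_eq_top isSl2Triple_sp4 (s := Set.range fun x : k × k × k =>
    sp4Matrix 0 0 0 0 x.1 x.2.1 x.2.2 0 0 0) ⟨(0, 1, 1), rfl⟩ ?_ lieSpan_sp4_eq_top ?_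
  · rintro _ ⟨⟨p, q, r⟩, rfl⟩
    refine ⟨2, ?_⟩
    rw [sp4Matrix_lie, sp4Matrix_smul]
    congr 1 <;> ring
  · rintro _ ⟨⟨p, q, r⟩, rfl⟩
    exact sp4Matrix_mem_e3 p q r

end Symplectic

section ExteriorSquare

variable (k : Type u) [Field k]

/-- The skew-symmetric `4 × 4` matrices, a model of the exterior square of `k⁴`. -/
def skewMatrices : Submodule k (Matrix (Fin 4) (Fin 4) k) where
  carrier := {X | X.transpose = -X}
  zero_mem' := by simp
  add_mem' {X Y} hX hY := by
    change (X + Y).transpose = -(X + Y)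
    rw [Matrix.transpose_add, hX, hY, neg_add]
  smul_mem' c X hX := by
    change (c • X).transpose = -(c • X)
    rw [Matrix.transpose_smul, hX, smul_neg]

variable {k}

theorem mem_skewMatrices {X : Matrix (Fin 4) (Fin 4) k} :
    X ∈ skewMatrices k ↔ X.transpose = -X := Iff.rfl

theorem mul_add_mul_transpose_mem {X : Matrix (Fin 4) (Fin 4) k} (hX : X ∈ skewMatrices k)
    (M : Matrix (Fin 4) (Fin 4) k) : M * X + X * M.transpose ∈ skewMatrices k := by
  rw [mem_skewMatrices] at hX ⊢
  rw [Matrix.transpose_add, Matrix.transpose_mul, Matrix.transpose_mul, hX,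
    Matrix.transpose_transpose]
  noncomm_ring

instance : LieRingModule (sl4 k) (skewMatrices k) where
  bracket M X := ⟨M.1 * X.1 + X.1 * M.1.transpose, mul_add_mul_transpose_mem X.2 M.1⟩
  add_lie M N X := Subtype.ext <| by
    change (M.1 + N.1) * X.1 + X.1 * (M.1 + N.1).transpose =
      M.1 * X.1 + X.1 * M.1.transpose + (N.1 * X.1 + X.1 * N.1.transpose)
    rw [Matrix.transpose_add]
    noncomm_ring
  lie_add M X Y := Subtype.ext <| by
    change M.1 * (X.1 + Y.1) + (X.1 + Y.1) * M.1.transpose =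
      M.1 * X.1 + X.1 * M.1.transpose + (M.1 * Y.1 + Y.1 * M.1.transpose)
    noncomm_ring
  leibniz_lie M N X := Subtype.ext <| by
    change M.1 * (N.1 * X.1 + X.1 * N.1.transpose) +
        (N.1 * X.1 + X.1 * N.1.transpose) * M.1.transpose =
      (M.1 * N.1 - N.1 * M.1) * X.1 + X.1 * (M.1 * N.1 - N.1 * M.1).transpose +
        (N.1 * (M.1 * X.1 + X.1 * M.1.transpose) +
          (M.1 * X.1 + X.1 * M.1.transpose) * N.1.transpose)
    rw [Matrix.transpose_sub, Matrix.transpose_mul, Matrix.transpose_mul]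
    noncomm_ring

instance : LieModule k (sl4 k) (skewMatrices k) where
  smul_lie c M X := Subtype.ext <| by
    change (c • M.1) * X.1 + X.1 * (c • M.1).transpose = c • (M.1 * X.1 + X.1 * M.1.transpose)
    rw [Matrix.transpose_smul, smul_mul_assoc, mul_smul_comm, smul_add]
  lie_smul c M X := Subtype.ext <| by
    change M.1 * (c • X.1) + (c • X.1) * M.1.transpose = c • (M.1 * X.1 + X.1 * M.1.transpose)
    rw [smul_mul_assoc, mul_smul_comm, smul_add]

/-- The element `eᵢ ∧ eⱼ` of the exterior square. -/
def wedge (i j : Fin 4) : skewMatrices k :=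
  ⟨Matrix.single i j 1 - Matrix.single j i 1, by rw [mem_skewMatrices]; simp⟩

theorem wedge_swap (i j : Fin 4) : wedge (k := k) i j = -wedge j i := by
  apply Subtype.ext
  change Matrix.single i j 1 - Matrix.single j i 1 = -(Matrix.single j i 1 - Matrix.single i j 1)
  abel

/-- The elementary matrix with entry `1` at an off-diagonal position, as an element of `sl₄`. -/
def offDiagonalSingle {i j : Fin 4} (h : i ≠ j) : sl4 k :=
  ⟨Matrix.single i j 1, Matrix.trace_single_eq_of_ne i j (1 : k) h⟩

theorem lie_offDiagonalSingle_lie (X : skewMatrices k) {i j m l : Fin 4} (hmi : m ≠ i) (hlj : l ≠ j)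
    (hli : l ≠ i) :
    ⁅offDiagonalSingle (k := k) hmi, ⁅offDiagonalSingle (k := k) hlj, X⁆⁆ = X.1 i j • wedge m l := by
  have hX : X.1 j i = -X.1 i j := congr_fun (congr_fun X.2 i) j
  apply Subtype.ext
  change Matrix.single m i 1 * (Matrix.single l j 1 * X.1 + X.1 * (Matrix.single l j 1).transpose) +
    (Matrix.single l j 1 * X.1 + X.1 * (Matrix.single l j 1).transpose) *
      (Matrix.single m i 1).transpose =
    X.1 i j • (Matrix.single m l 1 - Matrix.single l m 1)
  rw [Matrix.transpose_single, Matrix.transpose_single, mul_add, add_mul, ← mul_assoc, mul_assoc X.1,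
    Matrix.single_mul_single_of_ne _ _ _ _ hli.symm, Matrix.single_mul_single_of_ne _ _ _ _ hli,
    zero_mul, mul_zero, zero_add, add_zero, ← mul_assoc, Matrix.single_mul_mul_single,
    Matrix.single_mul_mul_single, hX]
  simp [Matrix.smul_single, sub_eq_add_neg, ← Matrix.single_neg]

theorem two_smul_eq_sum_wedge (X : skewMatrices k) :
    (2 : k) • X = ∑ i, ∑ j, X.1 i j • wedge i j := by
  have h : ∑ i, ∑ j, X.1 i j • (Matrix.single i j (1 : k) - Matrix.single j i 1) =
      X.1 - X.1.transpose := by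
    conv_rhs => rw [Matrix.matrix_eq_sum_single X.1]
    simp [smul_sub, Finset.sum_sub_distrib, Matrix.transpose_sum, Matrix.smul_single]
  apply Subtype.ext
  have hX := mem_skewMatrices.1 X.2
  rw [hX, sub_neg_eq_add, ← two_smul k] at h
  simpa [wedge] using h.symm

theorem isIrreducible_skewMatrices [CharZero k] :
    LieModule.IsIrreducible k (sl4 k) (skewMatrices k) := by
  have hw : wedge (k := k) 0 1 ≠ 0 := by
    intro h
    have := congr_fun (congr_fun (congr_arg Subtype.val h) 0) 1
    simp [wedge] at this
  have : Nontrivial (skewMatrices k) := ⟨_, _, hw⟩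
  refine LieModule.IsIrreducible.mk fun N hN => ?_
  obtain ⟨X, hX, hX0⟩ := (Submodule.ne_bot_iff N.toSubmodule).1
    (mt (LieSubmodule.toSubmodule_eq_bot N).1 hN)
  obtain ⟨i, j, hij⟩ : ∃ i j, X.1 i j ≠ 0 := by
    by_contra! h
    exact hX0 (Subtype.ext (Matrix.ext h))
  have step {Y : skewMatrices k} (hY : Y ∈ N) {i j m l : Fin 4} (h0 : Y.1 i j ≠ 0) (hmi : m ≠ i)
      (hlj : l ≠ j) (hli : l ≠ i) : wedge m l ∈ N := by
    have h : Y.1 i j • wedge m l ∈ N := by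
      rw [← lie_offDiagonalSingle_lie Y hmi hlj hli]
      exact N.lie_mem (N.lie_mem hY)
    have := N.smul_mem (Y.1 i j)⁻¹ h
    rwa [smul_smul, inv_mul_cancel₀ h0, one_smul] at this
  have hswap {i j : Fin 4} (h : wedge i j ∈ N) : wedge j i ∈ N := by
    rw [wedge_swap]; exact N.neg_mem h
  have hstep {i j m l : Fin 4} (hij : i ≠ j) (h : wedge i j ∈ N) (hmi : m ≠ i) (hlj : l ≠ j)
      (hli : l ≠ i) : wedge m l ∈ N :=
    step h (by simp [wedge, Matrix.single, hij.symm]) hmi hlj hli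
  have hsome : ∃ i j, i ≠ j ∧ wedge i j ∈ N := by
    obtain ⟨m, l, hml, hmi, hlj, hli⟩ :
      ∃ m l : Fin 4, m ≠ l ∧ m ≠ i ∧ l ≠ j ∧ l ≠ i := by
        clear hij
        revert i j
        decide
    exact ⟨m, l, hml, step hX hij hmi hlj hli⟩
  obtain ⟨a, b, hab, hN'⟩ := hsome
  have hall (m l : Fin 4) : wedge m l ∈ N := by
    by_cases hl : l ≠ b ∧ l ≠ a
    · by_cases hm : m = a
      · exact hstep hab.symm (hswap hN') (hm ▸ hab) hl.2 hl.1
      · exact hstep hab hN' hm hl.1 hl.2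
    by_cases hm : m ≠ b ∧ m ≠ a
    · refine hswap ?_
      by_cases hl : l = a
      · exact hstep hab.symm (hswap hN') (hl ▸ hab) hm.2 hm.1
      · exact hstep hab hN' hl hm.1 hm.2
    have h0 (i : Fin 4) : wedge (k := k) i i ∈ N := by
      have : wedge (k := k) i i = 0 := Subtype.ext (sub_self _)
      rw [this]; exact N.zero_mem
    have hl' : l = b ∨ l = a := by tauto
    have hm' : m = b ∨ m = a := by tauto
    rcases hl' with rfl | rfl <;> rcases hm' with rfl | rfl
    · exact h0 _
    · exact hN'
    · exact hswap hN'
    · exact h0 _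
  refine (LieSubmodule.toSubmodule_eq_top _).1 (Submodule.eq_top_iff'.2 fun Y => ?_)
  have h2 : (2 : k) • Y ∈ N := by
    rw [two_smul_eq_sum_wedge]
    exact sum_mem fun i _ => sum_mem fun j _ => N.smul_mem _ (hall i j)
  have := N.smul_mem (2 : k)⁻¹ h2
  rwa [smul_smul, inv_mul_cancel₀ two_ne_zero, one_smul] at this

theorem Psi_mul_Psi : Psi k * Psi k = -1 := by
  ext i j
  fin_cases i <;> fin_cases j <;> simp [Psi, Matrix.mul_apply, Fin.sum_univ_four]

theorem mul_Psi_add {M : Matrix (Fin 4) (Fin 4) k} (hM : M ∈ sp4 k) :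
    M * Psi k + Psi k * M.transpose = 0 := by
  have h : Psi k * (M.transpose * Psi k) * Psi k = Psi k * (Psi k * (-M)) * Psi k := by
    rw [(mem_sp4_iff.1 hM).2]
  rw [← mul_assoc, mul_assoc, Psi_mul_Psi, ← mul_assoc, Psi_mul_Psi] at h
  simp only [mul_neg, mul_one, neg_mul, one_mul, neg_neg] at h
  rw [← h, neg_add_cancel]

theorem coe_mem_e3 (M : e3InSl4 k) : M.1.1 ∈ e3 k := (LieSubalgebra.mem_ofLe _ M.1).1 M.2

variable (k) in
/-- The skew form of `sp₄`, as an invariant element of the exterior square. -/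
def skewPsi : skewMatrices k := ⟨Psi k, by
  rw [mem_skewMatrices]
  ext i j
  fin_cases i <;> fin_cases j <;> simp [Psi]⟩

variable (k) in
/-- The line spanned by the invariant element. -/
def invariantLine : LieSubmodule k (e3InSl4 k) (skewMatrices k) where
  toSubmodule := Submodule.span k {skewPsi k}
  lie_mem {M X} hX := by
    obtain ⟨c, rfl⟩ := Submodule.mem_span_singleton.1 hX
    have h : ⁅M, c • skewPsi k⁆ = 0 := by
      have h0 : ⁅M.1, skewPsi k⁆ = 0 := Subtype.ext (mul_Psi_add (e3_le_sp4 k (coe_mem_e3 M)))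
      exact (lie_smul c M.1 (skewPsi k)).trans (by rw [h0, smul_zero])
    exact h ▸ zero_mem (Submodule.span k {skewPsi k})

variable (k) in
/-- The pairing with the skew form. -/
def psiTrace : skewMatrices k →ₗ[k] k where
  toFun X := (Psi k * X.1).trace
  map_add' X Y := by simp [mul_add]
  map_smul' c X := by simp

variable (k) in
/-- The kernel of the pairing with the skew form. -/
def primitivePart : LieSubmodule k (e3InSl4 k) (skewMatrices k) where
  toSubmodule := LinearMap.ker (psiTrace k)
  lie_mem {M X} hX := by
    change (Psi k * (M.1.1 * X.1 + X.1 * M.1.1.transpose)).trace = 0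
    have hM : M.1.1.transpose * Psi k = Psi k * (-M.1.1) := (mem_sp4_iff.1 (e3_le_sp4 k (coe_mem_e3 M))).2
    rw [mul_add, Matrix.trace_add, ← mul_assoc (Psi k) X.1, Matrix.trace_mul_comm (Psi k * X.1),
      ← mul_assoc, ← mul_assoc, hM, ← Matrix.trace_add, ← add_mul]
    simp

theorem psiTrace_skewPsi : psiTrace k (skewPsi k) = -4 := by
  change (Psi k * Psi k).trace = -4
  rw [Psi_mul_Psi]
  simp [Matrix.trace_neg]

theorem not_isWide_e3InSl4 [CharZero k] : ¬ IsWide k (e3InSl4 k) := by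
  intro h
  have h4 : (-4 : k) ≠ 0 := by norm_num
  refine h (skewMatrices k) inferInstance isIrreducible_skewMatrices
    ⟨invariantLine k, primitivePart k, ?_, ?_, ?_⟩
  · intro htop
    have : wedge (k := k) 0 1 ∈ Submodule.span k {skewPsi k} := by
      change _ ∈ invariantLine k
      rw [htop]; exact LieSubmodule.mem_top _
    obtain ⟨c, hc⟩ := Submodule.mem_span_singleton.1 this
    have := congr_fun (congr_fun (congr_arg Subtype.val hc) 0) 1
    simp [wedge, skewPsi, Psi] at this
  · intro htop
    have : skewPsi k ∈ primitivePart k := by rw [htop]; exact LieSubmodule.mem_top _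
    exact h4 (psiTrace_skewPsi (k := k) ▸ this)
  · rw [← LieSubmodule.isCompl_toSubmodule]
    have hpsi : psiTrace k (skewPsi k) ≠ 0 := psiTrace_skewPsi (k := k) ▸ h4
    constructor
    · rw [Submodule.disjoint_def]
      intro X hX hX'
      obtain ⟨c, rfl⟩ := Submodule.mem_span_singleton.1 hX
      have h0 : psiTrace k (c • skewPsi k) = 0 := hX'
      rw [map_smul, smul_eq_mul, mul_eq_zero] at h0
      rw [h0.resolve_right hpsi, zero_smul]
    · rw [codisjoint_iff, Submodule.eq_top_iff']
      intro X
      refine Submodule.mem_sup.2 ⟨(psiTrace k X / psiTrace k (skewPsi k)) • skewPsi k,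
        Submodule.smul_mem _ _ (Submodule.mem_span_singleton_self _),
        X - (psiTrace k X / psiTrace k (skewPsi k)) • skewPsi k, ?_, add_sub_cancel _ _⟩
      change psiTrace k (X - _) = 0
      rw [map_sub, map_smul, smul_eq_mul, div_mul_cancel₀ _ hpsi, sub_self]

end ExteriorSquare

end WideSubalgebra

theorem mainTheorem5 (k : Type u) [Field k] [IsAlgClosed k] [CharZero k] :
    Nonempty (WideSubalgebra.e3 k ≃ₗ⁅k⁆ WideSubalgebra.Euclidean3 k) ∧
    WideSubalgebra.IsWide k (WideSubalgebra.e3InSp4 k) ∧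
    ¬ WideSubalgebra.IsWide k (WideSubalgebra.e3InSl4 k) ∧
    (WideSubalgebra.p2Nilradical k).toSubmodule ≤ (WideSubalgebra.e3InSp4 k).toSubmodule := by
  exact ⟨WideSubalgebra.nonempty_e3_equiv_euclidean3 k, WideSubalgebra.isWide_e3InSp4 k,
    WideSubalgebra.not_isWide_e3InSl4, WideSubalgebra.p2Nilradical_le_e3⟩
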